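/- **Setting.** Let $N$ be a finite set of random variables, where variable $v$ takes values in a standard Borel space, let $p$ be their joint distribution, and let $W$ be a partition of $N$ into nonempty groups. A DAG on $N$ is a variable DAG, a DAG on $W$ a group DAG. In a DAG, $u\neq v$ are d-connected by a node set $Z\not\ni u,v$ along a path of the skeleton if every head-to-head node of the path is in $Z$ or has a descendant in $Z$ and no other node of the path is in $Z$; they are d-separated by $Z$ if they are d-connected along no path; node sets are d-separated if their elements are pairwise d-separated. Two DAGs are Markov equivalent if they have the same d-separations. The distribution $p$ is *faithful* to a variable DAG $A$ if, for all $u\ne v$ and $Z\subseteq N\setminus\{u,v\}$, $u\perp v\mid Z$ in $p$ if and only if $u,v$ are d-separated by $Z$ in $A$. It is *groupwise faithful* to a group DAG $G'$ given $W$ if, for all distinct groups $W_i,W_j$ and $T\subseteq W\setminus\{W_i,W_j\}$, $W_i\perp W_j\mid\bigcup T$ in $p$ if and only if $W_i,W_j$ are d-separated by $T$ in $G'$. **PC algorithm** with independence test $I$. (1) Start from the complete graph. For $\ell=0,1,2,\dots$: as long as there are adjacent $x,y$ and a set $S$ of $\ell$ neighbours of $x$ other than $y$ with $I(x,y,S)$,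 delete the edge $x-y$ and record $S$ as the separating set of $x,y$; stop when no $x$ has more than $\ell$ neighbours other than some adjacent $y$. (2) For all $x-y-z$ with $x,z$ non-adjacent, orient $x\to y\leftarrow z$ if and only if $y$ is not in the recorded separating set of $x,z$. (3) As long as possible: if $a\to b$, $b-c$ is undirected and $a,c$ are non-adjacent, orient $b\to c$; if there is a directed path from $a$ to $b$ and $a-b$ is undirected, orient $a\to b$. (4) Return a DAG obtained by orienting the remaining edges without creating a new v-structure. The choices in these steps are arbitrary. **Algorithm FindGroupDAG2.** Run PC on $N$ with a test of conditional independence of variables, obtaining a variable DAG $H$; then run PC on $W$, where the test declares $W_i,W_j$ independent given $T$ if and only if the sets $W_i$ and $W_j$ are d-separated by $\bigcup T$ in $H$; return the group DAG obtained. **Theorem.** Let $p$ be the joint distribution of a Bayesian network $(G,\Theta)$ on $N$, all of whose variables are observed (causal sufficiency). Assume that $p$ is faithful to some variable DAG (for instance $G$) and that $p$ is groupwise faithful to a group DAG $G'$ given $W$. 1. (Infinite sample.) If the test of the first run of PC is exact, that is, it declares $u,v$ independent given $Z$ if and only if $u\perp v\mid Z$ in $p$, then FindGroupDAG2, whatever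 choices are made, terminates and returns a group DAG that is Markov equivalent to $G'$. 2. (Sample size tending to infinity.) If the test of the first run of PC is computed from $n$ independent observations from $p$ and is consistent at $p$, that is, for each $u\neq v$ and $Z\subseteq N\setminus\{u,v\}$ the probability of a wrong verdict tends to $0$ as $n\to\infty$, then the probability that FindGroupDAG2, whatever choices are made, terminates and returns a group DAG that is Markov equivalent to $G'$ tends to $1$ as $n\to\infty$. (Probabilities of events that need not be measurable are read as: the outer measure of the complementary event tends to $0$.) -/

import Mathlib

open MeasureTheory ProbabilityTheory Filter Topology
open scoped ENNReal

namespace GroupDAG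

/-! ### Directed acyclic graphs, d-separation, Markov equivalence -/

/-- A directed acyclic graph on the node set `V`; `G.Adj u v` is the arc `u → v`. -/
structure DAG (V : Type*) extends Digraph V where
  acyclic : ∀ v, ¬ Relation.TransGen Adj v v

namespace DAG

variable {V : Type*}

/-- The skeleton: arcs replaced by undirected edges. -/
def skeleton (G : DAG V) : SimpleGraph V := G.toDigraph.toSimpleGraphInclusive

/-- `d` is a (proper) descendant of `v`. -/
def Descendant (G : DAG V) (v d : V) : Prop := Relation.TransGen G.Adj v d

/-- `b` is a head-to-head node along the walk `q`: it occurs in `q` between two neighbours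
`a` and `c` with arcs `a → b` and `c → b`. -/
def HeadToHead (G : DAG V) {u v : V} (q : G.skeleton.Walk u v) (b : V) : Prop :=
  ∃ a c, [a, b, c] <:+: q.support ∧ G.Adj a b ∧ G.Adj c b

/-- `u` and `v` are d-connected by `Z` along some path: every head-to-head node of the path is in
`Z` or has a descendant in `Z`, and no other node of the path is in `Z`. -/
def DConnected (G : DAG V) (u v : V) (Z : Finset V) : Prop :=
  ∃ q : G.skeleton.Walk u v, q.IsPath ∧ ∀ b ∈ q.support,
    (G.HeadToHead q b → b ∈ Z ∨ ∃ d ∈ Z, G.Descendant b d) ∧ (¬ G.HeadToHead q b → b ∉ Z)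

/-- `u` and `v` are d-separated by `Z`. -/
def DSep (G : DAG V) (u v : V) (Z : Finset V) : Prop := ¬ G.DConnected u v Z

/-- The node sets `T` and `U` are d-separated by `Z`. -/
def SetDSep (G : DAG V) (T U Z : Finset V) : Prop := ∀ t ∈ T, ∀ u ∈ U, G.DSep t u Z

/-- Two DAGs are Markov equivalent if they imply the same conditional independencies. -/
def MarkovEquivalent (G H : DAG V) : Prop :=
  ∀ (u v : V) (Z : Finset V), u ≠ v → u ∉ Z → v ∉ Z → (G.DSep u v Z ↔ H.DSep u v Z)

end DAG

/-! ### Distributions, Bayesian networks, faithfulness -/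

section Distribution

variable {N : Type*} [Fintype N] {α : N → Type*} [∀ v, MeasurableSpace (α v)]

/-- A Bayesian network `(G, Θ)` on variables `v : N` with value spaces `α v`: a DAG and, for every
node, a conditional distribution of the node given its parents. -/
structure BayesNet (α : N → Type*) [∀ v, MeasurableSpace (α v)] where
  dag : DAG N
  θ : ∀ v, Kernel (∀ u : {u // dag.Adj u v}, α u) (α v)
  markov : ∀ v, IsMarkovKernel (θ v)

/-- The nodes other than `v` that are not descendants of `v`. -/
abbrev NonDescendant (G : DAG N) (v : N) : Type _ := {u : N // u ≠ v ∧ ¬ G.Descendant v u}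

/-- `p` is the joint distribution given by the Bayesian network `B`: the conditional distribution
of each variable `x v` given its non-descendants is `θ v`, evaluated at the parents of `v`
(the local Markov condition with the local parameters `θ v`). -/
def BayesNet.Generates (B : BayesNet α) (p : Measure (∀ v, α v)) : Prop :=
  ∀ (v : N) (A : Set (∀ u : NonDescendant B.dag v, α u)) (C : Set (α v)),
    MeasurableSet A → MeasurableSet C →
      p {x | (fun u : NonDescendant B.dag v => x u) ∈ A ∧ x v ∈ C} =
        ∫⁻ x in {x | (fun u : NonDescendant B.dag v => x u) ∈ A},
          B.θ v (fun u : {u // B.dag.Adj u v} => x u) C ∂p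

variable [∀ v, StandardBorelSpace (α v)]

/-- `T ⫫ U | S` in `p`: the sub-vectors with indices in `T` and in `U` are conditionally independent
given the sub-vector with indices in `S`. -/
def CondIndepSets (p : Measure (∀ v, α v)) [IsFiniteMeasure p] (T U S : Finset N) : Prop :=
  CondIndepFun (MeasurableSpace.comap (S.restrict (π := α)) inferInstance)
    (Finset.measurable_restrict S).comap_le (T.restrict (π := α)) (U.restrict (π := α)) p

/-- `p` is faithful to the DAG `G`: they imply the same conditional independencies. -/
def Faithful (p : Measure (∀ v, α v)) [IsFiniteMeasure p] (G : DAG N) : Prop :=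
  ∀ (u v : N) (Z : Finset N), u ≠ v → u ∉ Z → v ∉ Z →
    (CondIndepSets p {u} {v} Z ↔ G.DSep u v Z)

variable [DecidableEq N]

/-- The union of a set of groups. -/
def unionOf {W : Finpartition (Finset.univ : Finset N)} (T : Finset W.parts) : Finset N :=
  T.biUnion fun A => A.1

/-- `p` is groupwise faithful to the group DAG `H` given the grouping `W`: they imply the same
conditional independencies over groups. -/
def GroupwiseFaithful (p : Measure (∀ v, α v)) [IsFiniteMeasure p]
    (W : Finpartition (Finset.univ : Finset N)) (H : DAG W.parts) : Prop :=
  ∀ (A B : W.parts) (T : Finset W.parts), A ≠ B → A ∉ T → B ∉ T →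
    (CondIndepSets p A.1 B.1 (unionOf T) ↔ H.DSep A B T)

end Distribution

/-! ### The PC algorithm -/

/-- For a nondeterministic procedure with one-step relation `step`: every run from `s` is finite,
and every state in which a run stops satisfies `Q`. -/
def Guarantees {σ : Type*} (step : σ → σ → Prop) (s : σ) (Q : σ → Prop) : Prop :=
  Acc (flip step) s ∧ ∀ t, Relation.ReflTransGen step s t → (∀ t', ¬ step t t') → Q t

namespace PC

variable {V : Type*}

/-- State of the edge-deletion phase: the current undirected graph, the recorded separating sets,
and the size of the conditioning sets that are currently tested. -/
structure SkelState (V : Type*) where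
  graph : SimpleGraph V
  sepset : Sym2 V → Finset V
  level : ℕ

/-- The edge-deletion phase starts from the complete graph at level `0`. -/
def SkelState.init (V : Type*) : SkelState V := ⟨⊤, fun _ => ∅, 0⟩

/-- The pair `x, y` is adjacent and `S` is a set of `level` neighbours of `x` other than `y` such
that the test declares `x` and `y` independent given `S`. -/
def SkelState.Removable (indep : V → V → Finset V → Prop) (s : SkelState V)
    (x y : V) (S : Finset V) : Prop :=
  s.graph.Adj x y ∧ (S : Set V) ⊆ s.graph.neighborSet x \ {y} ∧ S.card = s.level ∧ indep x y S

open Classical in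
/-- One step of the edge-deletion phase. Either delete an edge whose endpoints are found to be
independent given a set of the current size, and record that set; or, if there is no such edge and
some node still has sufficiently many neighbours, pass to the next size. -/
inductive SkelStep (indep : V → V → Finset V → Prop) : SkelState V → SkelState V → Prop
  | delete (s : SkelState V) (x y : V) (S : Finset V) (h : s.Removable indep x y S) :
      SkelStep indep s
        ⟨s.graph.deleteEdges {s(x, y)}, Function.update s.sepset s(x, y) S, s.level⟩
  | next (s : SkelState V) (hdone : ∀ x y S, ¬ s.Removable indep x y S)
      (hmore : ∃ x y, s.graph.Adj x y ∧ s.level + 1 ≤ (s.graph.neighborSet x \ {y}).ncard) :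
      SkelStep indep s ⟨s.graph, s.sepset, s.level + 1⟩

/-- A partially oriented graph; `head x y` says that the edge `x - y` has an arrowhead at `y`. -/
structure Pattern (V : Type*) where
  graph : SimpleGraph V
  head : V → V → Prop

namespace Pattern

/-- The edge `x → y`. -/
def Directed (P : Pattern V) (x y : V) : Prop := P.graph.Adj x y ∧ P.head x y ∧ ¬ P.head y x

/-- The edge `x - y` without arrowheads. -/
def Undirected (P : Pattern V) (x y : V) : Prop := P.graph.Adj x y ∧ ¬ P.head x y ∧ ¬ P.head y x

/-- Add an arrowhead at `y` to the edge `x - y`. -/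
def orient (P : Pattern V) (x y : V) : Pattern V :=
  ⟨P.graph, fun a b => P.head a b ∨ (a = x ∧ b = y)⟩

/-- Collider orientation: for all `x - y - z` with `x, z` non-adjacent, orient `x → y ← z` if and
only if `y` is not in the separating set recorded for `x, z`. -/
def colliders (s : SkelState V) : Pattern V where
  graph := s.graph
  head x y := ∃ z, x ≠ z ∧ s.graph.Adj x y ∧ s.graph.Adj z y ∧ ¬ s.graph.Adj x z ∧
    y ∉ s.sepset s(x, z)

/-- One step of the orientation-propagation phase. -/
inductive Step : Pattern V → Pattern V → Prop
  | awayFromCollider (P : Pattern V) (a b c : V) (hab : P.Directed a b) (hbc : P.Undirected b c)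
      (hne : a ≠ c) (hac : ¬ P.graph.Adj a c) : Step P (P.orient b c)
  | awayFromCycle (P : Pattern V) (a b : V) (hpath : Relation.TransGen P.Directed a b)
      (hab : P.Undirected a b) : Step P (P.orient a b)

/-- `H` is a DAG represented by the pattern `P`: it arises by orienting the remaining edges without
introducing a v-structure that is not present in `P`. -/
def Represents (P : Pattern V) (H : DAG V) : Prop :=
  H.skeleton = P.graph ∧ (∀ a b, P.Directed a b → H.Adj a b) ∧
    ∀ a b c, a ≠ c → H.Adj a b → H.Adj c b → ¬ P.graph.Adj a c →
      P.Directed a b ∧ P.Directed c b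

end Pattern

/-- Whatever choices are made (order of tests, order of orientations, DAG chosen from the final
pattern), the PC algorithm with the independence test `indep` terminates and returns a DAG that
satisfies `Q`. The phases are: edge deletion, collider orientation, orientation propagation, and
the choice of a DAG represented by the final pattern, of which there must be at least one. -/
def Returns (indep : V → V → Finset V → Prop) (Q : DAG V → Prop) : Prop :=
  Guarantees (SkelStep indep) (SkelState.init V) fun s =>
    Guarantees Pattern.Step (Pattern.colliders s) fun P =>
      (∃ H, P.Represents H) ∧ ∀ H, P.Represents H → Q H

end PC

/-- Whatever choices are made in the two runs of the PC algorithm, the algorithm `FindGroupDAG2`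
terminates and returns a group DAG that satisfies `Q`: first the PC algorithm with the independence
test `indep` on the variables returns a variable DAG `H`, then the PC algorithm on the groups, with
d-separation of groups in `H` as the independence test, returns a group DAG. -/
def FindGroupDAG2Returns {N : Type*} [Fintype N] [DecidableEq N]
    (indep : N → N → Finset N → Prop) (W : Finpartition (Finset.univ : Finset N))
    (Q : DAG W.parts → Prop) : Prop :=
  PC.Returns indep fun H =>
    PC.Returns (fun (A B : W.parts) (T : Finset W.parts) => H.SetDSep A.1 B.1 (unionOf T)) Q

section Tests

variable {N : Type*} [Fintype N] {α : N → Type*} [∀ v, MeasurableSpace (α v)]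
  [∀ v, StandardBorelSpace (α v)]

/-- `test n D u v Z` is the verdict "`u` and `v` are independent given `Z`" from `n` observations
`D`. The tests are consistent at `p` if, for each `u, v, Z`, the probability of a wrong verdict on
`n` independent observations from `p` tends to `0` as `n → ∞`. -/
def ConsistentTests (p : Measure (∀ v, α v)) [IsProbabilityMeasure p]
    (test : (n : ℕ) → (Fin n → ∀ v, α v) → N → N → Finset N → Prop) : Prop :=
  ∀ (u v : N) (Z : Finset N), u ≠ v → u ∉ Z → v ∉ Z →
    Tendsto (fun n => Measure.pi (fun _ : Fin n => p)
      {D | ¬ (test n D u v Z ↔ CondIndepSets p {u} {v} Z)}) atTop (𝓝 0)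

end Tests

end GroupDAG

/-! PC is correct for every test that answers like d-separation in some DAG
(`PC.returns_of_isOracle`), and this is applied twice. By faithfulness an exact test is such an
oracle for `A`, so the first run yields some `H` equivalent to `A`, and `p` is faithful to `H` as
well. The second run is correct once d-separation of groups in `H` agrees with conditional
independence of groups in `p`, which groupwise faithfulness identifies with d-separation in `G'`.

That agreement (`Faithful.condIndepSets_iff`) is the bridge: pairwise independence of members does
not in general give joint independence. Pairwise d-separation of two sets, however, survives adding
other members of these sets to the conditioning set (`DAG.SetDSep.dSep_union`). Faithfulness turns
all these separations into independencies, and contraction assembles them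
(`condIndepSets_of_forall_subset`).

In PC, true edges are never deleted. A false edge cannot survive, because one endpoint is a
non-descendant of the other and is separated from it by that node's parents, which remain among its
neighbours. All arrowheads are forced, so the true DAG stays represented, and every represented DAG
shares its skeleton and v-structures. Hence it has the same d-separations
(`DAG.SameVStructures.markovEquivalent`), proved by transferring shortest active walks.

For large samples, only finitely many queries exist, so a union bound makes all verdicts correct
with probability tending to 1. -/

namespace GroupDAG

/-! ### Contraction for conditionally independent σ-algebras. -/

section ConditionalIndependence

variable {Ω : Type*} {mΩ : MeasurableSpace Ω}

lemma sup_eq_generateFrom_inter (m₁ m₂ : MeasurableSpace Ω) :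
    m₁ ⊔ m₂ = MeasurableSpace.generateFrom
      {s | ∃ b c, MeasurableSet[m₁] b ∧ MeasurableSet[m₂] c ∧ s = b ∩ c} := by
  apply le_antisymm
  · refine sup_le (fun s hs => ?_) (fun s hs => ?_)
    · exact MeasurableSpace.measurableSet_generateFrom
        ⟨s, Set.univ, hs, MeasurableSet.univ, by simp⟩
    · exact MeasurableSpace.measurableSet_generateFrom
        ⟨Set.univ, s, MeasurableSet.univ, hs, by simp⟩
  · refine MeasurableSpace.generateFrom_le ?_
    rintro _ ⟨b, c, hb, hc, rfl⟩
    exact MeasurableSet.inter ((le_sup_left : m₁ ≤ m₁ ⊔ m₂) _ hb)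
      ((le_sup_right : m₂ ≤ m₁ ⊔ m₂) _ hc)

lemma isPiSystem_inter_measurableSet (m₁ m₂ : MeasurableSpace Ω) :
    IsPiSystem {s | ∃ b c, MeasurableSet[m₁] b ∧ MeasurableSet[m₂] c ∧ s = b ∩ c} := by
  rintro _ ⟨b, c, hb, hc, rfl⟩ _ ⟨b', c', hb', hc', rfl⟩ -
  exact ⟨b ∩ b', c ∩ c', hb.inter hb', hc.inter hc', Set.inter_inter_inter_comm ..⟩

lemma indicator_one_inter (s t : Set Ω) :
    (s ∩ t).indicator (fun _ => (1 : ℝ)) =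
      s.indicator (fun _ => (1 : ℝ)) * t.indicator (fun _ => (1 : ℝ)) := by
  ext x
  by_cases hs : x ∈ s <;> by_cases ht : x ∈ t <;> simp [hs, ht]

variable {μ : Measure Ω} [IsFiniteMeasure μ]

lemma integrable_indicator_one {s : Set Ω} (hs : MeasurableSet s) :
    Integrable (s.indicator fun _ => (1 : ℝ)) μ :=
  (integrable_const 1).indicator hs

lemma condExp_indicator_mul {m : MeasurableSpace Ω} (hm : m ≤ mΩ) {s : Set Ω}
    (hs : MeasurableSet[m] s) {f : Ω → ℝ} (hf : Integrable f μ) :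
    μ[s.indicator (fun _ => (1 : ℝ)) * f | m] =ᵐ[μ] s.indicator (fun _ => (1 : ℝ)) * μ[f | m] := by
  refine condExp_stronglyMeasurable_mul_of_bound hm
    (stronglyMeasurable_const.indicator hs) hf 1 (Eventually.of_forall fun x => ?_)
  by_cases hx : x ∈ s <;> simp [hx]

variable [StandardBorelSpace Ω] {m' m₁ m₂ m₃ : MeasurableSpace Ω}

/-- The intersections `b ∩ c` form a π-system generating `m₂ ⊔ m₃`, so the product formula need only
be checked on them. -/
lemma condIndep_sup_right (hm' : m' ≤ mΩ) (h₁ : m₁ ≤ mΩ) (h₂ : m₂ ≤ mΩ) (h₃ : m₃ ≤ mΩ)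
    (h : ∀ a b c, MeasurableSet[m₁] a → MeasurableSet[m₂] b → MeasurableSet[m₃] c →
      μ⟦a ∩ (b ∩ c) | m'⟧ =ᵐ[μ] μ⟦a | m'⟧ * μ⟦b ∩ c | m'⟧) :
    CondIndep m' m₁ (m₂ ⊔ m₃) hm' μ := by
  refine CondIndepSets.condIndep h₁ (sup_le h₂ h₃) (p1 := {s | MeasurableSet[m₁] s})
    (@MeasurableSpace.isPiSystem_measurableSet _ m₁)
    (isPiSystem_inter_measurableSet m₂ m₃) (@MeasurableSpace.generateFrom_measurableSet _ m₁).symm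
    (sup_eq_generateFrom_inter m₂ m₃) ?_
  rw [condIndepSets_iff]
  · rintro a _ ha ⟨b, c, hb, hc, rfl⟩
    exact h a b c ha hb hc
  · exact fun s hs => h₁ s hs
  · rintro _ ⟨b, c, hb, hc, rfl⟩
    exact (h₂ b hb).inter (h₃ c hc)

lemma _root_.ProbabilityTheory.CondIndep.sup_conditioning (hm' : m' ≤ mΩ) (h₁ : m₁ ≤ mΩ)
    (h₂ : m₂ ≤ mΩ) (h : CondIndep m' m₁ m₂ hm' μ) : CondIndep m' m₁ (m' ⊔ m₂) hm' μ := by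
  rw [condIndep_iff m' m₁ m₂ hm' h₁ h₂] at h
  refine condIndep_sup_right hm' h₁ hm' h₂ fun a b c ha hb hc => ?_
  have e : a ∩ (b ∩ c) = b ∩ (a ∩ c) := Set.inter_left_comm ..
  have hac := integrable_indicator_one (μ := μ) ((h₁ a ha).inter (h₂ c hc))
  rw [e, indicator_one_inter b (a ∩ c), indicator_one_inter b c]
  filter_upwards [condExp_indicator_mul hm' hb hac,
    condExp_indicator_mul hm' hb (integrable_indicator_one (μ := μ) (h₂ c hc)),
    h a c ha hc] with x hx1 hx2 hx3
  rw [hx1, Pi.mul_apply, Pi.mul_apply, hx2, Pi.mul_apply, hx3, Pi.mul_apply]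
  ring

/-- Conditioning also on a conditionally independent σ-algebra changes nothing. -/
lemma _root_.ProbabilityTheory.CondIndep.condExp_sup_eq (hm' : m' ≤ mΩ) (h₁ : m₁ ≤ mΩ)
    (h₂ : m₂ ≤ mΩ) (h : CondIndep m' m₁ m₂ hm' μ) {a : Set Ω} (ha : MeasurableSet[m₁] a) :
    μ⟦a | m'⟧ =ᵐ[μ] μ⟦a | m' ⊔ m₂⟧ := by
  have h' := (condIndep_iff m' m₁ (m' ⊔ m₂) hm' h₁ (sup_le hm' h₂) μ).1
    (h.sup_conditioning hm' h₁ h₂)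
  have hia := integrable_indicator_one (μ := μ) (h₁ a ha)
  refine ae_eq_condExp_of_forall_setIntegral_eq (sup_le hm' h₂) hia
    (fun s _ _ => integrable_condExp.integrableOn) (fun s hs _ => ?_)
    (stronglyMeasurable_condExp.mono le_sup_left).aestronglyMeasurable
  have hs' : MeasurableSet[mΩ] s := (sup_le hm' h₂) s hs
  have his := integrable_indicator_one (μ := μ) hs'
  -- Set integrals become integrals of products, so that the product formula for `a` and `s`, both
  -- conditioned on `m'`, can be applied.
  have key : ∀ f : Ω → ℝ, ∫ x in s, f x ∂μ =
      ∫ x, (f * s.indicator (fun _ => (1 : ℝ))) x ∂μ := fun f => by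
    rw [← integral_indicator hs']
    congr 1
    ext x
    by_cases hx : x ∈ s <;> simp [hx]
  have hprod : Integrable (μ⟦a | m'⟧ * s.indicator (fun _ => (1 : ℝ))) μ := by
    have := (integrable_condExp (μ := μ) (m := m')
      (f := a.indicator (fun _ => (1 : ℝ)))).indicator hs'
    refine this.congr (Eventually.of_forall fun x => ?_)
    by_cases hx : x ∈ s <;> simp [hx]
  rw [key, key, ← integral_condExp hm', ← indicator_one_inter,
    ← integral_condExp (f := (a ∩ s).indicator _) hm']
  refine integral_congr_ae ?_
  refine (condExp_mul_of_stronglyMeasurable_left stronglyMeasurable_condExp hprod his).trans ?_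
  exact (h' a s ha hs).symm

/-- Contraction. -/
lemma _root_.ProbabilityTheory.CondIndep.contraction (hm' : m' ≤ mΩ) (h₁ : m₁ ≤ mΩ)
    (h₂ : m₂ ≤ mΩ) (h₃ : m₃ ≤ mΩ) (h : CondIndep m' m₁ m₂ hm' μ)
    (h' : CondIndep (m' ⊔ m₂) m₁ m₃ (sup_le hm' h₂) μ) : CondIndep m' m₁ (m₂ ⊔ m₃) hm' μ := by
  refine condIndep_sup_right hm' h₁ h₂ h₃ fun a b c ha hb hc => ?_
  have hM : m' ⊔ m₂ ≤ mΩ := sup_le hm' h₂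
  have hb' : MeasurableSet[m' ⊔ m₂] b := (le_sup_right : m₂ ≤ m' ⊔ m₂) b hb
  have hbc : MeasurableSet[mΩ] (b ∩ c) := (h₂ b hb).inter (h₃ c hc)
  have hia := integrable_indicator_one (μ := μ) (h₁ a ha)
  have hic := integrable_indicator_one (μ := μ) (h₃ c hc)
  have hac := integrable_indicator_one (μ := μ) ((h₁ a ha).inter (h₃ c hc))
  have e : a ∩ (b ∩ c) = b ∩ (a ∩ c) := Set.inter_left_comm ..
  -- Given `m' ⊔ m₂` the indicator of `b` factors out, `a` and `c` are independent, and the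
  -- conditional probability of `a` reduces to that given `m'`. The tower property then brings the
  -- identity down to `m'`.
  have s1 : μ⟦a ∩ (b ∩ c) | m' ⊔ m₂⟧ =ᵐ[μ] μ⟦a | m'⟧ * μ⟦b ∩ c | m' ⊔ m₂⟧ := by
    rw [e, indicator_one_inter b (a ∩ c), indicator_one_inter b c]
    filter_upwards [condExp_indicator_mul hM hb' hac, condExp_indicator_mul hM hb' hic,
      (condIndep_iff _ m₁ m₃ hM h₁ h₃ μ).1 h' a c ha hc,
      h.condExp_sup_eq hm' h₁ h₂ ha] with x hx1 hx2 hx3 hx4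
    rw [hx1, Pi.mul_apply, Pi.mul_apply, hx2, Pi.mul_apply, hx3, Pi.mul_apply, hx4]
    ring
  have hint : Integrable (μ⟦a | m'⟧ * μ⟦b ∩ c | m' ⊔ m₂⟧) μ :=
    integrable_condExp.congr s1
  have s2 := (condExp_condExp_of_le (f := (a ∩ (b ∩ c)).indicator fun _ => (1 : ℝ)) (μ := μ)
    (le_sup_left : m' ≤ m' ⊔ m₂) hM).symm
  have s3 := condExp_condExp_of_le (f := (b ∩ c).indicator fun _ => (1 : ℝ)) (μ := μ)
    (le_sup_left : m' ≤ m' ⊔ m₂) hM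
  refine s2.trans ((condExp_congr_ae s1).trans ?_)
  refine (condExp_mul_of_stronglyMeasurable_left stronglyMeasurable_condExp hint
    integrable_condExp).trans ?_
  filter_upwards [s3] with x hx
  rw [Pi.mul_apply, Pi.mul_apply, hx]

end ConditionalIndependence

/-! ### Conditional independence of sub-vectors. -/

section SubVectors

variable {N : Type*} {α : N → Type*} [∀ v, MeasurableSpace (α v)]

/-- The σ-algebra generated by the sub-vector with indices in `S`. -/
abbrev subSigma (α : N → Type*) [∀ v, MeasurableSpace (α v)] (S : Finset N) :
    MeasurableSpace (∀ v, α v) :=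
  MeasurableSpace.comap (S.restrict (π := α)) inferInstance

lemma subSigma_le (S : Finset N) : subSigma α S ≤ MeasurableSpace.pi :=
  (Finset.measurable_restrict S).comap_le

lemma subSigma_eq_iSup (S : Finset N) :
    subSigma α S = ⨆ v ∈ S, MeasurableSpace.comap (fun x : ∀ v, α v => x v) inferInstance := by
  rw [subSigma, MeasurableSpace.pi, MeasurableSpace.comap_iSup, iSup_subtype]
  simp only [MeasurableSpace.comap_comp]
  rfl

lemma subSigma_union [DecidableEq N] (S T : Finset N) :
    subSigma α (S ∪ T) = subSigma α S ⊔ subSigma α T := by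
  simp only [subSigma_eq_iSup, Finset.mem_union, iSup_or, iSup_sup_eq]

lemma subSigma_mono {S T : Finset N} (h : S ⊆ T) : subSigma α S ≤ subSigma α T := by
  rw [subSigma_eq_iSup, subSigma_eq_iSup]
  exact biSup_mono fun _ hi => h hi

lemma subSigma_empty : subSigma α ∅ = ⊥ := by simp [subSigma_eq_iSup]

variable [Fintype N] [∀ v, StandardBorelSpace (α v)] {p : Measure (∀ v, α v)} [IsFiniteMeasure p]
  {T U S : Finset N}

lemma condIndepSets_iff_condIndep : CondIndepSets p T U S ↔
    CondIndep (subSigma α S) (subSigma α T) (subSigma α U) (subSigma_le S) p :=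
  condIndepFun_iff_condIndep ..

lemma CondIndepSets.symm (h : CondIndepSets p T U S) : CondIndepSets p U T S :=
  CondIndepFun.symm h

lemma CondIndepSets.mono {T' U' : Finset N} (h : CondIndepSets p T U S) (hT : T' ⊆ T)
    (hU : U' ⊆ U) : CondIndepSets p T' U' S := by
  rw [condIndepSets_iff_condIndep] at h ⊢
  exact condIndep_of_condIndep_of_le_left
    (condIndep_of_condIndep_of_le_right h (subSigma_mono hU)) (subSigma_mono hT)

lemma condIndepSets_empty_right : CondIndepSets p T ∅ S := by
  rw [condIndepSets_iff_condIndep, subSigma_empty]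
  exact condIndep_bot_right _

variable [DecidableEq N]

lemma CondIndepSets.contraction {U' : Finset N} (h : CondIndepSets p T U S)
    (h' : CondIndepSets p T U' (S ∪ U)) : CondIndepSets p T (U ∪ U') S := by
  rw [condIndepSets_iff_condIndep] at h h' ⊢
  have key := h.contraction (subSigma_le S) (subSigma_le T) (subSigma_le U) (subSigma_le U')
  simp only [← subSigma_union] at key
  exact key h'

/-- A family of conditional independencies of single variables yields a conditional independence
of sets of variables by repeated contraction. -/
lemma condIndepSets_of_forall_subset
    (h : ∀ t ∈ T, ∀ u ∈ U, ∀ T' ⊆ T.erase t, ∀ U' ⊆ U.erase u,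
      CondIndepSets p {t} {u} (S ∪ T' ∪ U')) : CondIndepSets p T U S := by
  -- `U` is built up by contraction for a single `t`; the extra set `T'` stays in the condition
  -- because it is needed when `T` is built up next, with the two sides swapped.
  have row : ∀ t ∈ T, ∀ T' ⊆ T.erase t, ∀ U' ⊆ U, CondIndepSets p {t} U' (S ∪ T') := by
    intro t ht T' hT' U'
    induction U' using Finset.induction_on with
    | empty => exact fun _ => condIndepSets_empty_right
    | insert u U' hu ih =>
      intro hU
      have := (ih ((Finset.subset_insert _ _).trans hU)).contraction
        (h t ht u (hU (Finset.mem_insert_self _ _)) T' hT' U' fun x hx =>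
          Finset.mem_erase.2 ⟨fun e => hu (e ▸ hx), hU (Finset.mem_insert_of_mem hx)⟩)
      rwa [Finset.union_comm, ← Finset.insert_eq] at this
  have all : ∀ T' ⊆ T, CondIndepSets p U T' S := by
    intro T'
    induction T' using Finset.induction_on with
    | empty => exact fun _ => condIndepSets_empty_right
    | insert t T' ht ih =>
      intro hT
      have := (ih ((Finset.subset_insert _ _).trans hT)).contraction
        (row t (hT (Finset.mem_insert_self _ _)) T' (fun x hx =>
          Finset.mem_erase.2 ⟨fun e => ht (e ▸ hx), hT (Finset.mem_insert_of_mem hx)⟩)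
          U subset_rfl).symm
      rwa [Finset.union_comm, ← Finset.insert_eq] at this
  exact (all T subset_rfl).symm

end SubVectors

/-! ### Active walks and d-connection. -/

namespace DAG

variable {V : Type*} {G H : DAG V} {Z : Finset V}

lemma adj_asymm {a b : V} (h : G.Adj a b) : ¬ G.Adj b a :=
  fun h' => G.acyclic a ((Relation.TransGen.single h).tail h')

lemma skeleton_adj {a b : V} : G.skeleton.Adj a b ↔ G.Adj a b ∨ G.Adj b a := by
  refine ⟨fun h => h.2, fun h => ⟨?_, h⟩⟩
  rintro rfl
  exact G.acyclic a (Relation.TransGen.single (h.elim id id))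

lemma skeleton_of_adj {a b : V} (h : G.Adj a b) : G.skeleton.Adj a b := skeleton_adj.2 (.inl h)

/-- `b` belongs to `Z` or has a descendant in `Z`. -/
def Anc (G : DAG V) (Z : Finset V) (b : V) : Prop := b ∈ Z ∨ ∃ d ∈ Z, G.Descendant b d

lemma Anc.of_adj {a b : V} (h : G.Anc Z b) (hab : G.Adj a b) : ∃ d ∈ Z, G.Descendant a d := by
  rcases h with h | ⟨d, hd, hbd⟩
  · exact ⟨b, h, .single hab⟩
  · exact ⟨d, hd, .head hab hbd⟩

/-- The consecutive nodes `a, b, c` of a walk do not block it, given `Z`. -/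
def Opens (G : DAG V) (Z : Finset V) (a b c : V) : Prop :=
  (G.Adj a b ∧ G.Adj c b ∧ G.Anc Z b) ∨ (¬ (G.Adj a b ∧ G.Adj c b) ∧ b ∉ Z)

lemma Opens.symm {a b c : V} (h : G.Opens Z a b c) : G.Opens Z c b a := by
  unfold Opens at *; tauto

lemma Opens.congr_right {a b c c' : V} (h : G.Opens Z a b c) (hc : G.Adj c b ↔ G.Adj c' b) :
    G.Opens Z a b c' := by
  unfold Opens at *; tauto

/-- The list is a walk of the skeleton that is active given `Z`. Nodes may be repeated. -/
def Active (G : DAG V) (Z : Finset V) : List V → Prop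
  | [] => True
  | [_] => True
  | [a, b] => G.skeleton.Adj a b
  | a :: b :: c :: l => G.skeleton.Adj a b ∧ G.Opens Z a b c ∧ Active G Z (b :: c :: l)

lemma active_cons_cons {a b : V} {l : List V} : G.Active Z (a :: b :: l) ↔
    G.skeleton.Adj a b ∧ (∀ c ∈ l.head?, G.Opens Z a b c) ∧ G.Active Z (b :: l) := by
  cases l <;> simp [Active]

lemma active_append {a : V} {l₁ l₂ : List V} : G.Active Z (l₁ ++ a :: l₂) ↔
    G.Active Z (l₁ ++ [a]) ∧ G.Active Z (a :: l₂) ∧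
      ∀ d ∈ l₁.getLast?, ∀ e ∈ l₂.head?, G.Opens Z d a e := by
  induction l₁ with
  | nil => simp [Active]
  | cons x l₁ ih =>
    cases l₁ with
    | nil =>
      simp only [List.cons_append, List.nil_append, active_cons_cons (l := l₂)]
      simp [Active]
      tauto
    | cons y l₁ =>
      simp only [List.cons_append, active_cons_cons] at ih ⊢
      rw [ih]
      have : (l₁ ++ a :: l₂).head? = (l₁ ++ [a]).head? := by cases l₁ <;> simp
      rw [this]
      simp only [List.getLast?_cons_cons]
      tauto

lemma Active.reverse : ∀ {l : List V}, G.Active Z l → G.Active Z l.reverse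
  | [], h => h
  | [_], h => h
  | [_, _], h => SimpleGraph.Adj.symm h
  | a :: b :: c :: l, h => by
    have e : (a :: b :: c :: l).reverse = (l.reverse ++ [c]) ++ b :: [a] := by simp
    rw [e, active_append]
    refine ⟨by simpa using Active.reverse h.2.2, h.1.symm, ?_⟩
    simpa using h.2.1.symm

lemma Active.isChain : ∀ {l : List V}, G.Active Z l → l.IsChain G.skeleton.Adj
  | [], _ => by simp
  | [_], _ => by simp
  | a :: b :: l, h => by
    rw [active_cons_cons] at h
    exact List.IsChain.cons_cons h.1 (Active.isChain h.2.2)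

lemma active_of_isChain : ∀ {l : List V}, l.IsChain G.skeleton.Adj →
    (∀ a b c, [a, b, c] <:+: l → G.Opens Z a b c) → G.Active Z l
  | [], _, _ => trivial
  | [_], _, _ => trivial
  | a :: b :: l, h, h' => by
    rw [active_cons_cons]
    rw [List.isChain_cons_cons] at h
    refine ⟨h.1, fun c hc => h' a b c ?_, active_of_isChain h.2
      fun x y z hx => h' x y z (List.infix_cons hx)⟩
    obtain ⟨r, rfl⟩ := List.head?_eq_some_iff.1 hc
    exact ⟨[], r, rfl⟩

lemma Active.opens {l₁ l₂ : List V} {a b c : V} (h : G.Active Z (l₁ ++ a :: b :: c :: l₂)) :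
    G.skeleton.Adj a b ∧ G.skeleton.Adj b c ∧ G.Opens Z a b c := by
  obtain ⟨-, h, -⟩ := active_append.1 h
  rw [active_cons_cons, active_cons_cons] at h
  exact ⟨h.1, h.2.2.1, h.2.1 c rfl⟩

/-- An active walk that starts along an arc leads to a descendant, or to a head-to-head node. -/
lemma Active.descendant {a b w : V} {l : List V} (h : G.Active Z (a :: b :: l)) (hab : G.Adj a b)
    (hw : w ∈ (b :: l).getLast?) : G.Descendant a w ∨ ∃ z ∈ Z, G.Descendant a z := by
  induction l generalizing a b with
  | nil =>
    obtain rfl : b = w := by simpa using hw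
    exact .inl (.single hab)
  | cons c l ih =>
    obtain ⟨-, ho, h⟩ := h
    rcases ho with ⟨-, -, hb⟩ | ⟨hn, -⟩
    · exact .inr (hb.of_adj hab)
    · have hbc : G.Adj b c :=
        (skeleton_adj.1 (active_cons_cons.1 h).1).resolve_right fun hc => hn ⟨hab, hc⟩
      rcases ih h hbc (by simpa using hw) with h | ⟨z, hz, h⟩
      · exact .inl (.head hab h)
      · exact .inr ⟨z, hz, .head hab h⟩

/-- `u` and `v` are joined by an active walk. -/
def Joined (G : DAG V) (Z : Finset V) (u v : V) (l : List V) : Prop :=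
  G.Active Z l ∧ l.head? = some u ∧ l.getLast? = some v

lemma Joined.reverse {u v : V} {l : List V} (h : G.Joined Z u v l) :
    G.Joined Z v u l.reverse :=
  ⟨h.1.reverse, by simp [h.2.2], by simp [h.2.1]⟩

lemma exists_append_of_not_nodup {l : List V} (h : ¬ l.Nodup) :
    ∃ a l₁ l₂ l₃, l = l₁ ++ a :: (l₂ ++ a :: l₃) := by
  induction l with
  | nil => simp at h
  | cons x l ih =>
    by_cases hx : x ∈ l
    · obtain ⟨s, t, rfl⟩ := List.append_of_mem hx
      exact ⟨x, [], s, t, rfl⟩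
    · obtain ⟨a, l₁, l₂, l₃, rfl⟩ := ih fun hl => h (List.nodup_cons.2 ⟨hx, hl⟩)
      exact ⟨a, x :: l₁, l₂, l₃, rfl⟩

/-- A closed part of an active walk can be cut out. -/
lemma Active.cut {a : V} {l₁ l₂ l₃ : List V} (h : G.Active Z (l₁ ++ a :: (l₂ ++ a :: l₃))) :
    G.Active Z (l₁ ++ a :: l₃) := by
  obtain ⟨h₁, h₂, h₁₂⟩ := active_append.1 h
  obtain ⟨h₂, h₃, h₂₃⟩ := (active_append (l₁ := a :: l₂)).1 h₂
  refine active_append.2 ⟨h₁, h₃, fun d hd e he => ?_⟩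
  -- `f` follows the first `a` and `g` precedes the second. If `d → a ← e` was not already a
  -- collider in `d, a, f`, the loop leaves `a` along an arc; it cannot return as a directed cycle,
  -- so it meets a collider and `a` has a descendant in `Z`. If `d, a, e` is no collider, an old
  -- triple at `a` was none either.
  obtain ⟨f, hf⟩ : ∃ f, (l₂ ++ [a]).head? = some f := by cases l₂ <;> simp
  obtain ⟨r, hr⟩ := List.head?_eq_some_iff.1 hf
  have hof : G.Opens Z d a f := by
    refine h₁₂ d hd f ?_
    cases l₂ <;> simpa using hf
  obtain ⟨g, hg⟩ : ∃ g, (a :: l₂).getLast? = some g := by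
    cases hh : (a :: l₂).getLast? <;> simp at hh ⊢
  have hog := h₂₃ g hg e he
  by_cases hda : G.Adj d a
  · by_cases hea : G.Adj e a
    · refine .inl ⟨hda, hea, ?_⟩
      rcases hof with ⟨-, -, hA⟩ | ⟨hn, -⟩
      · exact hA
      · rw [List.cons_append, hr] at h₂
        have haf : G.Adj a f :=
          (skeleton_adj.1 (active_cons_cons.1 h₂).1).resolve_right fun hc => hn ⟨hda, hc⟩
        have hlast : a ∈ (f :: r).getLast? := by rw [← hr]; simp
        exact (h₂.descendant haf hlast).elim (fun h => (G.acyclic a h).elim) .inr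
    · refine .inr ⟨fun h => hea h.2, ?_⟩
      rcases hog with ⟨-, hA, -⟩ | ⟨-, hn⟩
      · exact (hea hA).elim
      · exact hn
  · refine .inr ⟨fun h => hda h.1, ?_⟩
    rcases hof with ⟨hA, -⟩ | ⟨-, hn⟩
    · exact (hda hA).elim
    · exact hn

/-- A shortest active walk. -/
def Shortest (G : DAG V) (Z : Finset V) (u v : V) (l : List V) : Prop :=
  G.Joined Z u v l ∧ ∀ l', G.Joined Z u v l' → l.length ≤ l'.length

lemma Joined.exists_shortest {u v : V} {l : List V} (h : G.Joined Z u v l) :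
    ∃ l, G.Shortest Z u v l := by
  classical
  have hex : ∃ n, ∃ l, G.Joined Z u v l ∧ l.length = n := ⟨_, l, h, rfl⟩
  obtain ⟨l₀, h₀, hl₀⟩ := Nat.find_spec hex
  exact ⟨l₀, h₀, fun l' hl' => hl₀ ▸ Nat.find_min' hex ⟨l', hl', rfl⟩⟩

lemma Shortest.nodup {u v : V} {l : List V} (h : G.Shortest Z u v l) : l.Nodup := by
  by_contra hn
  obtain ⟨a, l₁, l₂, l₃, rfl⟩ := exists_append_of_not_nodup hn
  have := h.2 (l₁ ++ a :: l₃) ⟨h.1.1.cut, ?_, ?_⟩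
  · simp at this
    omega
  · rw [← h.1.2.1]; simp
  · rw [← h.1.2.2]; simp [List.getLast?_append, List.getLast?_cons]

/-- A shortest active walk repeats no node, since closed parts can be cut out. The endpoints are
never head-to-head, hence the assumptions on `u` and `v`. -/
lemma dConnected_of_joined {u v : V} {l : List V} (hu : u ∉ Z) (hv : v ∉ Z)
    (h : G.Joined Z u v l) : G.DConnected u v Z := by
  obtain ⟨l, hs⟩ := h.exists_shortest
  have hn := hs.nodup
  obtain ⟨⟨ha, hhead, hlast⟩, -⟩ := hs
  have hne : l ≠ [] := by rintro rfl; simp at hhead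
  have hhead' : l.head hne = u := by
    rw [List.head?_eq_some_head hne] at hhead; simpa using hhead
  have hlast' : l.getLast hne = v := by
    rw [List.getLast?_eq_some_getLast hne] at hlast; simpa using hlast
  subst hhead' hlast'
  have hsupp := SimpleGraph.Walk.support_ofSupport hne ha.isChain
  refine ⟨SimpleGraph.Walk.ofSupport l hne ha.isChain, ?_, fun b hb => ⟨?_, fun hb' => ?_⟩⟩
  · rw [SimpleGraph.Walk.isPath_def, hsupp]
    exact hn
  · rintro ⟨a, c, hin, hab, hcb⟩
    rw [hsupp] at hin
    obtain ⟨s, t, rfl⟩ := hin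
    have := (Active.opens (l₁ := s) (l₂ := t) (by simpa using ha)).2.2
    rcases this with h | h
    · exact h.2.2
    · exact (h.1 ⟨hab, hcb⟩).elim
  · rw [hsupp] at hb
    obtain ⟨s, t, e⟩ := List.append_of_mem hb
    rcases List.eq_nil_or_concat s with rfl | ⟨s, a, rfl⟩
    · simpa [e] using hu
    rcases t with _ | ⟨c, t⟩
    · simpa [e] using hv
    have e' : l = s ++ a :: b :: c :: t := by simpa using e
    rw [e'] at ha
    rcases ha.opens.2.2 with h | h
    · exact (hb' ⟨a, c, by rw [hsupp, e']; exact ⟨s, t, by simp⟩, h.1, h.2.1⟩).elim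
    · exact h.2

/-- On a path each inner node lies in a single triple, so being head-to-head along the path is a
property of that triple. -/
lemma joined_of_dConnected {u v : V} (h : G.DConnected u v Z) : ∃ l, G.Joined Z u v l := by
  obtain ⟨q, hq, h⟩ := h
  refine ⟨q.support, active_of_isChain q.isChain_adj_support fun a b c hin => ?_, ?_, ?_⟩
  · have hb : b ∈ q.support := hin.subset (by simp)
    by_cases hc : G.Adj a b ∧ G.Adj c b
    · exact .inl ⟨hc.1, hc.2, (h b hb).1 ⟨a, c, hin, hc⟩⟩
    · refine .inr ⟨hc, (h b hb).2 ?_⟩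
      rintro ⟨a', c', hin', hac⟩
      apply hc
      obtain ⟨s, t, e⟩ := hin
      obtain ⟨s', t', e'⟩ := hin'
      have hnd := hq.support_nodup
      have e₁ : q.support = (s ++ [a]) ++ b :: (c :: t) := by simp [← e]
      have e₂ : q.support = (s' ++ [a']) ++ b :: (c' :: t') := by simp [← e']
      rw [e₁] at hnd
      have hb₁ := fun hb => (List.nodup_append.1 hnd).2.2 b hb b (by simp) rfl
      have hb₂ : b ∉ c :: t := (List.nodup_cons.1 (List.nodup_append.1 hnd).2.1).1
      obtain ⟨hl, -, hr⟩ := (List.append_cons_inj_of_notMem hb₁ hb₂).1 (e₁.symm.trans e₂)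
      obtain rfl : a = a' := by simpa using (List.append_inj' hl rfl).2
      obtain rfl : c = c' := by simpa using congrArg List.head? hr
      exact hac
  · rw [List.head?_eq_some_head q.support_ne_nil]; simp
  · rw [List.getLast?_eq_some_getLast q.support_ne_nil]; simp

lemma DConnected.symm {u v : V} (hu : u ∉ Z) (hv : v ∉ Z) (h : G.DConnected u v Z) :
    G.DConnected v u Z :=
  (joined_of_dConnected h).elim fun _ hl => dConnected_of_joined hv hu hl.reverse

lemma DSep.symm {u v : V} (hu : u ∉ Z) (hv : v ∉ Z) (h : G.DSep u v Z) : G.DSep v u Z :=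
  fun h' => h (DConnected.symm hv hu h')

lemma dConnected_of_skeleton_adj {u v : V} (hu : u ∉ Z) (hv : v ∉ Z) (h : G.skeleton.Adj u v) :
    G.DConnected u v Z :=
  dConnected_of_joined (l := [u, v]) hu hv ⟨h, rfl, rfl⟩

/-- Separating sets of non-adjacent nodes contain the middle node of a path of length two unless
it is a head-to-head node. -/
lemma DSep.mem_iff {x y z : V} (h : G.DSep x z Z) (hx : x ∉ Z) (hz : z ∉ Z)
    (hxy : G.skeleton.Adj x y) (hyz : G.skeleton.Adj z y) :
    y ∉ Z ↔ G.Adj x y ∧ G.Adj z y := by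
  have key : ¬ G.Opens Z x y z := fun ho =>
    h (dConnected_of_joined (l := [x, y, z]) hx hz ⟨⟨hxy, ho, hyz.symm⟩, rfl, rfl⟩)
  unfold Opens Anc at key
  tauto

/-- The local Markov property: the parents of a node separate it from its non-descendants. -/
lemma dSep_parents {x y : V} (hne : x ≠ y) (hadj : ¬ G.skeleton.Adj x y)
    (hd : ¬ G.Descendant x y) (hZ : ∀ b, b ∈ Z ↔ G.Adj b x) : G.DSep x y Z := by
  intro h
  obtain ⟨l, ha, hh, hl⟩ := joined_of_dConnected h
  obtain ⟨l, rfl⟩ := List.head?_eq_some_iff.1 hh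
  rcases l with _ | ⟨b, l⟩
  · exact hne (by simpa using hl)
  rcases skeleton_adj.1 (active_cons_cons.1 ha).1 with hxb | hbx
  · rcases ha.descendant hxb (by simpa using hl) with h | ⟨z, hz, h⟩
    · exact hd h
    · exact G.acyclic x (h.tail ((hZ z).1 hz))
  · rcases l with _ | ⟨c, l⟩
    · obtain rfl : b = y := by simpa using hl
      exact hadj (skeleton_adj.2 (.inr hbx))
    · rcases ha.2.1 with h | h
      · exact adj_asymm hbx h.1
      · exact h.2 ((hZ b).2 hbx)

/-! ### Weak union and composition for d-separation. -/

lemma exists_active_of_descendant {b w : V} (h : G.Descendant b w) (hb : ¬ G.Anc Z b) :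
    ∃ c r, G.Adj b c ∧ G.Active Z (b :: c :: r) ∧ (b :: c :: r).getLast? = some w := by
  unfold Descendant at h
  induction h using Relation.TransGen.head_induction_on with
  | single h => exact ⟨w, [], h, skeleton_of_adj h, rfl⟩
  | head h h' ih =>
    rename_i b c
    -- The directed path to `w` avoids `Z`, as otherwise `b` would have a descendant in `Z`; its
    -- inner nodes are not colliders, so it is active.
    have hc : ¬ G.Anc Z c := fun hc => hb (.inr (hc.of_adj h))
    obtain ⟨d, r, hcd, ha, hl⟩ := ih hc
    exact ⟨c, d :: r, h, ⟨skeleton_of_adj h, .inr ⟨fun h => adj_asymm hcd h.2, fun h => hc (.inl h)⟩, ha⟩,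
      by simpa using hl⟩

/-- Removing `w` from the conditioning set keeps a walk active or opens a walk to `w`. -/
lemma Active.of_insert [DecidableEq V] {w a b : V} {l : List V}
    (h : G.Active (insert w Z) (a :: b :: l)) :
    G.Active Z (a :: b :: l) ∨
      ∃ r, G.Active Z (a :: b :: r) ∧ (a :: b :: r).getLast? = some w := by
  induction l generalizing a b with
  | nil => exact .inl h
  | cons c l ih =>
    obtain ⟨hab, ho, h⟩ := h
    by_cases hZ : G.Opens Z a b c
    · exact (ih h).imp (fun h => ⟨hab, hZ, h⟩)
        fun ⟨r, hr, hl⟩ => ⟨c :: r, ⟨hab, hZ, hr⟩, by simpa using hl⟩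
    · right
      unfold Opens at hZ ho
      have hb : ¬ G.Anc Z b := by
        rcases ho with ho | ho
        · tauto
        · simp only [Finset.mem_insert] at ho
          tauto
      rcases ho with ⟨-, -, (hw | ⟨d, hd, hbd⟩)⟩ | ho
      · rcases Finset.mem_insert.1 hw with rfl | hw
        · exact ⟨[], hab, rfl⟩
        · exact (hb (.inl hw)).elim
      · rcases Finset.mem_insert.1 hd with rfl | hd
        · obtain ⟨c', r, hbc, ha, hl⟩ := exists_active_of_descendant hbd hb
          exact ⟨c' :: r, ⟨hab, .inr ⟨fun h => adj_asymm hbc h.2, fun h => hb (.inl h)⟩, ha⟩,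
            by simpa using hl⟩
        · exact (hb (.inr ⟨d, hd, hbd⟩)).elim
      · simp only [Finset.mem_insert] at ho
        tauto

/-- In contrapositive form: if `Z` separates `u` from both `v` and `w`, then `w` may join the
condition. This combines composition and weak union. -/
lemma DConnected.of_insert [DecidableEq V] {u v w : V} (hu : u ∉ Z) (hv : v ∉ Z) (hw : w ∉ Z)
    (hne : u ≠ v) (h : G.DConnected u v (insert w Z)) :
    G.DConnected u v Z ∨ G.DConnected u w Z := by
  obtain ⟨l, ha, hh, hl⟩ := joined_of_dConnected h
  obtain ⟨l, rfl⟩ := List.head?_eq_some_iff.1 hh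
  rcases l with _ | ⟨b, l⟩
  · exact (hne (by simpa using hl)).elim
  exact ha.of_insert.imp (fun h => dConnected_of_joined hu hv ⟨h, rfl, hl⟩)
    fun ⟨r, hr, hl⟩ => dConnected_of_joined hu hw ⟨hr, rfl, hl⟩

/-- Weak union for d-separation of sets. -/
lemma SetDSep.dSep_union [DecidableEq V] {T U F : Finset V} (h : G.SetDSep T U Z)
    (hTU : Disjoint T U) (hTZ : Disjoint T Z) (hUZ : Disjoint U Z) (hF : F ⊆ T ∪ U)
    {t u : V} (ht : t ∈ T) (hu : u ∈ U) (htF : t ∉ F) (huF : u ∉ F) : G.DSep t u (Z ∪ F) := by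
  induction F using Finset.induction_on generalizing t u with
  | empty => simpa using h t ht u hu
  | insert w F hw ih =>
    have hne : ∀ t ∈ T, ∀ u ∈ U, t ≠ u := fun t ht u hu e => Finset.disjoint_left.1 hTU ht (e ▸ hu)
    have nT : ∀ t ∈ T, t ∉ F → t ∉ Z ∪ F := fun t ht hF => by
      simp [hF, Finset.disjoint_left.1 hTZ ht]
    have nU : ∀ t ∈ U, t ∉ F → t ∉ Z ∪ F := fun t ht hF => by
      simp [hF, Finset.disjoint_left.1 hUZ ht]
    have hF' := (Finset.subset_insert w F).trans hF
    have htF' : t ∉ F := fun h => htF (Finset.mem_insert_of_mem h)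
    have huF' : u ∉ F := fun h => huF (Finset.mem_insert_of_mem h)
    rw [Finset.union_insert]
    intro hc
    have h₁ := ih hF' ht hu htF' huF'
    rcases Finset.mem_union.1 (hF (Finset.mem_insert_self w F)) with hwT | hwU
    · have hc' : G.DConnected u t (insert w (Z ∪ F)) := by
        refine hc.symm ?_ ?_
        · rw [Finset.mem_insert, not_or]
          exact ⟨fun e => htF (e ▸ Finset.mem_insert_self _ _), nT t ht htF'⟩
        · rw [Finset.mem_insert, not_or]
          exact ⟨fun e => huF (e ▸ Finset.mem_insert_self _ _), nU u hu huF'⟩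
      rcases hc'.of_insert (nU u hu huF') (nT t ht htF') (nT w hwT hw) (hne t ht u hu).symm
        with hc' | hc'
      · exact h₁ (hc'.symm (nU u hu huF') (nT t ht htF'))
      · exact ih hF' hwT hu hw huF' (hc'.symm (nU u hu huF') (nT w hwT hw))
    · rcases hc.of_insert (nT t ht htF') (nU u hu huF') (nU w hwU hw) (hne t ht u hu)
        with hc' | hc'
      · exact h₁ hc'
      · exact ih hF' ht hwU htF' hw hc'

/-! ### Skeleton and v-structures determine all d-separations. -/

variable {u v : V}

/-- Two DAGs have the same skeleton and the same v-structures. -/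
structure SameVStructures (G H : DAG V) : Prop where
  skeleton_eq : G.skeleton = H.skeleton
  collider_iff : ∀ a b c, a ≠ c → ¬ G.skeleton.Adj a c →
    (G.Adj a b ∧ G.Adj c b ↔ H.Adj a b ∧ H.Adj c b)

lemma SameVStructures.symm (h : SameVStructures G H) : SameVStructures H G :=
  ⟨h.skeleton_eq.symm, fun a b c hac hn => (h.collider_iff a b c hac (h.skeleton_eq ▸ hn)).symm⟩

lemma Active.shortcut {a b c : V} {l₁ l₂ : List V} (h : G.Active Z (l₁ ++ a :: b :: c :: l₂))
    (hac : G.skeleton.Adj a c)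
    (hl : ∀ d ∈ l₁.getLast?, G.Opens Z d a b → G.Opens Z d a c)
    (hr : ∀ e ∈ l₂.head?, G.Opens Z b c e → G.Opens Z a c e) :
    G.Active Z (l₁ ++ a :: c :: l₂) := by
  obtain ⟨h₁, h₂, h₁₂⟩ := active_append.1 h
  rw [active_cons_cons, active_cons_cons] at h₂
  refine active_append.2 ⟨h₁, active_cons_cons.2 ⟨hac, ?_, h₂.2.2.2.2⟩, ?_⟩
  · exact fun e he => hr e he (h₂.2.2.2.1 e he)
  · intro d hd e he
    obtain rfl : c = e := by simpa using he
    exact hl d hd (h₁₂ d hd b rfl)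

lemma Shortest.not_shortcut {a b c : V} {l₁ l₂ : List V}
    (h : G.Shortest Z u v (l₁ ++ a :: b :: c :: l₂)) (hac : G.skeleton.Adj a c)
    (hl : ∀ d ∈ l₁.getLast?, G.Opens Z d a b → G.Opens Z d a c)
    (hr : ∀ e ∈ l₂.head?, G.Opens Z b c e → G.Opens Z a c e) : False := by
  have := h.2 (l₁ ++ a :: c :: l₂) ⟨h.1.1.shortcut hac hl hr, ?_, ?_⟩
  · simp at this
  · rw [← h.1.2.1]; simp
  · rw [← h.1.2.2]; simp [List.getLast?_append, List.getLast?_cons_cons]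

/-- The neighbours of a head-to-head node of a shortest active walk are not adjacent. -/
lemma Shortest.not_adj_of_collider {a b c : V} {l₁ l₂ : List V}
    (h : G.Shortest Z u v (l₁ ++ a :: b :: c :: l₂)) (hab : G.Adj a b) (hcb : G.Adj c b) :
    ¬ G.skeleton.Adj a c := by
  intro hac
  have hb : G.Anc Z b := h.1.1.opens.2.2.elim (fun h => h.2.2) fun h => (h.1 ⟨hab, hcb⟩).elim
  have hba := adj_asymm hab
  have hbc := adj_asymm hcb
  -- Bypassing `b` preserves the edge mark at the tail of the edge `a - c`. At its head a new
  -- collider may arise, which is harmless because that node inherits a descendant in `Z` through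
  -- `b`.
  rcases skeleton_adj.1 hac with hac' | hca'
  · have hc : G.Anc Z c := .inr (hb.of_adj hcb)
    have hca := adj_asymm hac'
    refine h.not_shortcut hac (fun d _ ho => ho.congr_right (by tauto)) fun e _ ho => ?_
    unfold Opens at *; tauto
  · have ha : G.Anc Z a := .inr (hb.of_adj hab)
    have hac'' := adj_asymm hca'
    refine h.not_shortcut hac (fun d _ ho => ?_) fun e _ ho => (ho.symm.congr_right
      (by tauto)).symm
    unfold Opens at *; tauto

lemma Shortest.ne {a b c : V} {l₁ l₂ : List V}
    (h : G.Shortest Z u v (l₁ ++ a :: b :: c :: l₂)) : a ≠ c := by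
  have := (List.nodup_append.1 h.nodup).2.1
  simp at this
  tauto

/-- The triples along a shortest active walk have the same type in both DAGs. -/
lemma Shortest.triple (hGH : SameVStructures G H) {a b c : V} {l₁ l₂ : List V}
    (h : G.Shortest Z u v (l₁ ++ a :: b :: c :: l₂)) :
    (G.Adj a b ∧ G.Adj c b ∧ H.Adj a b ∧ H.Adj c b ∧ ¬ G.skeleton.Adj a c ∧ G.Anc Z b) ∨
      (¬ (H.Adj a b ∧ H.Adj c b) ∧ b ∉ Z) := by
  obtain ⟨hab, hbc, ho⟩ := h.1.1.opens
  rcases ho with ⟨ha, hc, hb⟩ | ⟨hn, hb⟩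
  · have hac := h.not_adj_of_collider ha hc
    have := (hGH.collider_iff a b c h.ne hac).1 ⟨ha, hc⟩
    exact .inl ⟨ha, hc, this.1, this.2, hac, hb⟩
  refine .inr ⟨fun hH => ?_, hb⟩
  by_cases hac : G.skeleton.Adj a c
  swap
  · exact hn ((hGH.collider_iff a b c h.ne hac).2 hH)
  rw [skeleton_adj] at hab hbc
  -- A collider of `H` that is none in `G` must be shielded. If `G` has a chain through `b`,
  -- acyclicity orients the edge `a - c` along it, and the bypass keeps both end marks,
  -- contradicting minimality.
  have trans : ∀ x y z, G.skeleton.Adj x z → G.Adj x y → G.Adj y z → G.Adj x z :=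
    fun x y z hxz hxy hyz => (skeleton_adj.1 hxz).resolve_right fun hzx =>
      G.acyclic x (((Relation.TransGen.single hxy).tail hyz).tail hzx)
  by_cases hab' : G.Adj a b
  · have hbc' : G.Adj b c := hbc.resolve_right fun hcb => hn ⟨hab', hcb⟩
    have hac' := trans a b c hac hab' hbc'
    have h1 := adj_asymm hab'
    have h2 := adj_asymm hac'
    exact h.not_shortcut hac (fun d _ ho => ho.congr_right (by tauto))
      fun e _ ho => (ho.symm.congr_right (by tauto)).symm
  have hba := hab.resolve_left hab'
  by_cases hcb : G.Adj c b
  · have hca' := trans c b a hac.symm hcb hba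
    have h1 := adj_asymm hcb
    have h2 := adj_asymm hca'
    exact h.not_shortcut hac (fun d _ ho => ho.congr_right (by tauto))
      fun e _ ho => (ho.symm.congr_right (by tauto)).symm
  have hbc' := hbc.resolve_right hcb
  -- In a fork the bypass changes only the mark at the tail of the edge `a - c`. This matters only
  -- if that tail was a collider, which is unshielded by minimality, hence shared with `H`, against
  -- the direction of its edge to `b` in `H`.
  rcases skeleton_adj.1 hac with hac' | hca'
  · refine h.not_shortcut hac (fun d hd ho => ?_)
      fun e _ ho => (ho.symm.congr_right (by tauto)).symm
    by_cases hda : G.Adj d a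
    · exfalso
      obtain ⟨l₁, rfl⟩ := List.getLast?_eq_some_iff.1 hd
      rw [List.append_assoc] at h
      have hdb := h.not_adj_of_collider hda hba
      exact adj_asymm hH.1 ((hGH.collider_iff d a b h.ne hdb).1 ⟨hda, hba⟩).2
    · unfold Opens at *; tauto
  · refine h.not_shortcut hac (fun d _ ho => ho.congr_right (by tauto)) fun e he ho => ?_
    by_cases hec : G.Adj e c
    · exfalso
      obtain ⟨l₂, rfl⟩ := List.head?_eq_some_iff.1 he
      have h' : G.Shortest Z u v ((l₁ ++ [a]) ++ b :: c :: e :: l₂) := by simpa using h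
      have hbe := h'.not_adj_of_collider hbc' hec
      exact adj_asymm hH.2 ((hGH.collider_iff b c e h'.ne hbe).1 ⟨hbc', hec⟩).1
    · unfold Opens at *; tauto

/-- There is a directed walk of length `n` from `b` to a node in `Z`. -/
def ReachesIn (G : DAG V) (Z : Finset V) : ℕ → V → Prop
  | 0, b => b ∈ Z
  | n + 1, b => ∃ c, G.Adj b c ∧ ReachesIn G Z n c

lemma exists_reachesIn {b : V} (h : G.Anc Z b) : ∃ n, G.ReachesIn Z n b := by
  rcases h with h | ⟨d, hd, h⟩
  · exact ⟨0, h⟩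
  · unfold Descendant at h
    induction h using Relation.TransGen.head_induction_on with
    | single h => exact ⟨1, d, h, hd⟩
    | head h _ ih => exact ih.elim fun n hn => ⟨n + 1, _, h, hn⟩

lemma anc_of_adj {b c : V} (hbc : G.Adj b c) (h : G.Anc Z c) : G.Anc Z b := .inr (h.of_adj hbc)

lemma ReachesIn.anc {n : ℕ} {b : V} (h : G.ReachesIn Z n b) : G.Anc Z b := by
  induction n generalizing b with
  | zero => exact .inl h
  | succ n ih => exact h.elim fun c hc => anc_of_adj hc.1 (ih hc.2)

/-- A shortest directed walk to `Z` has no chords, so its triples are unshielded non-colliders in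
both DAGs, and the first arc forces all later arcs in `H`. -/
lemma anc_of_reachesIn (hGH : SameVStructures G H) {n : ℕ} {b c : V} (hbc : G.Adj b c)
    (hH : H.Adj b c) (hn : G.ReachesIn Z n c) (hmin : ∀ m < n + 1, ¬ G.ReachesIn Z m b) :
    H.Anc Z b := by
  induction n generalizing b c with
  | zero => exact .inr ⟨c, hn, .single hH⟩
  | succ n ih =>
    obtain ⟨d, hcd, hd⟩ := hn
    have hbcd := (Relation.TransGen.single hbc).tail hcd
    have hbd : ¬ G.skeleton.Adj b d := fun hbd => (skeleton_adj.1 hbd).elim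
      (fun h => hmin (n + 1) (by omega) ⟨d, h, hd⟩) fun h => G.acyclic b (hbcd.tail h)
    have hne : b ≠ d := by
      rintro rfl
      exact G.acyclic b hbcd
    have hcd' : H.Adj c d := by
      refine (skeleton_adj.1 (hGH.skeleton_eq ▸ skeleton_of_adj hcd)).resolve_right fun h => ?_
      exact adj_asymm hcd ((hGH.collider_iff b c d hne hbd).2 ⟨hH, h⟩).2
    exact anc_of_adj hH (ih hcd hcd' hd fun m hm hc => hmin (m + 1) (by omega) ⟨c, hbc, hc⟩)

/-- The head-to-head node of a v-structure with a descendant in `Z` can be replaced by one that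
has a descendant in `Z` in an equivalent DAG. -/
lemma exists_collider (hGH : SameVStructures G H) {a b c : V} (hne : a ≠ c)
    (hac : ¬ G.skeleton.Adj a c) (hab : G.Adj a b) (hcb : G.Adj c b) (hb : G.Anc Z b) :
    ∃ b', H.Adj a b' ∧ H.Adj c b' ∧ H.Anc Z b' := by
  obtain ⟨n, hn⟩ := exists_reachesIn hb
  induction n using Nat.strong_induction_on generalizing b with
  | _ n ih =>
  have hH := (hGH.collider_iff a b c hne hac).1 ⟨hab, hcb⟩
  by_cases hmin : ∃ m < n, G.ReachesIn Z m b
  · obtain ⟨m, hm, hb'⟩ := hmin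
    exact ih m hm hab hcb hb hb'
  push Not at hmin
  cases n with
  | zero => exact ⟨b, hH.1, hH.2, .inl hn⟩
  | succ n =>
    obtain ⟨w, hbw, hw⟩ := hn
    rcases skeleton_adj.1 (hGH.skeleton_eq ▸ skeleton_of_adj hbw) with hbw' | hwb
    · exact ⟨b, hH.1, hH.2, anc_of_reachesIn hGH hbw hbw' hw hmin⟩
    -- Here `H` has `x → b ← w` while `G` has `x → b → w`, so the triple is shielded and `x → w` in
    -- `G`. Thus `w` is a common child strictly closer to `Z`.
    · have key : ∀ x, G.Adj x b → H.Adj x b → G.Adj x w := by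
        intro x hxb hxb'
        have hxbw := (Relation.TransGen.single hxb).tail hbw
        have hxw : x ≠ w := by
          rintro rfl
          exact G.acyclic x hxbw
        by_contra hn
        refine adj_asymm hbw ((hGH.collider_iff x b w hxw fun h => ?_).2 ⟨hxb', hwb⟩).2
        exact (skeleton_adj.1 h).elim hn fun h => G.acyclic x (hxbw.tail h)
      refine ih n (Nat.lt_succ_self n) (key a hab hH.1) (key c hcb hH.2) hw.anc hw

/-- Transfer of an active walk: the second node may change, but not the direction of the first
edge. -/
lemma exists_active_transfer (hGH : SameVStructures G H) : ∀ {l : List V} {x y : V},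
    (x :: y :: l).IsChain G.skeleton.Adj →
    (∀ a b c, [a, b, c] <:+: x :: y :: l →
      (G.Adj a b ∧ G.Adj c b ∧ H.Adj a b ∧ H.Adj c b ∧ ¬ G.skeleton.Adj a c ∧ G.Anc Z b ∧ a ≠ c) ∨
        (¬ (H.Adj a b ∧ H.Adj c b) ∧ b ∉ Z)) →
    ∃ y' r, H.Active Z (x :: y' :: r) ∧ (x :: y' :: r).getLast? = (x :: y :: l).getLast? ∧
      (H.Adj x y → H.Adj x y') ∧ (H.Adj y x → H.Adj y' x)
  | [], x, y, hc, _ =>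
    ⟨y, [], show H.skeleton.Adj x y from hGH.skeleton_eq ▸ (List.isChain_cons_cons.1 hc).1,
      rfl, id, id⟩
  | z :: l, x, y, hc, h => by
    obtain ⟨hxy, hc'⟩ := List.isChain_cons_cons.1 hc
    obtain ⟨hyz, hc''⟩ := List.isChain_cons_cons.1 hc'
    rw [hGH.skeleton_eq] at hxy hyz
    rcases h x y z ⟨[], l, rfl⟩ with ⟨gxy, gzy, hxy', hzy', hxz, hy, hne⟩ | ⟨hn, hy⟩
    · obtain ⟨b, hxb, hzb, hb⟩ := exists_collider hGH hne hxz gxy gzy hy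
      rcases l with _ | ⟨w, l⟩
      · exact ⟨b, [z], ⟨skeleton_of_adj hxb, .inl ⟨hxb, hzb, hb⟩, (skeleton_of_adj hzb).symm⟩, rfl,
          fun _ => hxb, fun h => (adj_asymm h hxy').elim⟩
      -- The recursion restarts at `z`, past the replaced collider; `z` has an outgoing arc to the
      -- old and to the new collider, so it is a non-collider before and after.
      · obtain ⟨w', r, hr, hl, -, -⟩ := exists_active_transfer hGH hc'' fun a b c hin =>
          h a b c (List.infix_cons (List.infix_cons hin))
        have hz : z ∉ Z := by
          rcases h y z w ⟨[x], l, rfl⟩ with h | h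
          · exact (adj_asymm gzy h.1).elim
          · exact h.2
        refine ⟨b, z :: w' :: r, ⟨skeleton_of_adj hxb, .inl ⟨hxb, hzb, hb⟩,
          (skeleton_of_adj hzb).symm, .inr ⟨fun h => adj_asymm hzb h.1, hz⟩, hr⟩, ?_,
          fun _ => hxb, fun h => (adj_asymm h hxy').elim⟩
        simpa [List.getLast?_cons_cons] using hl
    -- Although `z` may become `z'`, the edge at `y` keeps its direction in `H`, so `y` stays a
    -- non-collider.
    · obtain ⟨z', r, hr, hl, h₁, h₂⟩ := exists_active_transfer hGH hc' fun a b c hin =>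
          h a b c (List.infix_cons hin)
      refine ⟨y, z' :: r, ⟨hxy, .inr ⟨fun h => hn ⟨h.1, ?_⟩, hy⟩, hr⟩, ?_, id, id⟩
      · exact (skeleton_adj.1 hyz).resolve_left fun h' => adj_asymm (h₁ h') h.2
      · simpa [List.getLast?_cons_cons] using hl

lemma SameVStructures.dConnected (hGH : SameVStructures G H) (huv : u ≠ v) (hu : u ∉ Z)
    (hv : v ∉ Z) (h : G.DConnected u v Z) : H.DConnected u v Z := by
  obtain ⟨_, hl⟩ := joined_of_dConnected h
  obtain ⟨l, hl⟩ := hl.exists_shortest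
  obtain ⟨l, rfl⟩ := List.head?_eq_some_iff.1 hl.1.2.1
  have hlast := hl.1.2.2
  rcases l with _ | ⟨y, l⟩
  · exact (huv (by simpa using hlast)).elim
  obtain ⟨y', r, hr, hl', -⟩ := exists_active_transfer (Z := Z) hGH hl.1.1.isChain (by
    rintro a b c ⟨s, t, e⟩
    rw [← e, List.append_assoc] at hl
    have hne := hl.ne
    have := hl.triple hGH
    tauto)
  exact dConnected_of_joined hu hv ⟨hr, rfl, hl'.trans hlast⟩

/-- DAGs with the same skeleton and the same v-structures are Markov equivalent. -/
theorem SameVStructures.markovEquivalent (h : SameVStructures G H) : G.MarkovEquivalent H :=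
  fun _ _ _ huv hu hv => not_congr ⟨h.dConnected huv hu hv, h.symm.dConnected huv hu hv⟩

end DAG
-- The measure `f` strictly decreases along runs, giving termination; the invariant reaches every
-- stopping state.
lemma guarantees_of_invariant {σ : Type*} {step : σ → σ → Prop} {s : σ} {Q : σ → Prop}
    (I : σ → Prop) (f : σ → ℕ) (hs : I s) (hstep : ∀ a b, I a → step a b → I b ∧ f b < f a)
    (hQ : ∀ t, I t → (∀ t', ¬ step t t') → Q t) : Guarantees step s Q := by
  refine ⟨?_, fun t ht => hQ t ?_⟩
  · induction hn : f s using Nat.strong_induction_on generalizing s with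
    | _ n ih =>
      refine ⟨s, fun t ht => ?_⟩
      obtain ⟨hI, hlt⟩ := hstep s t hs ht
      exact ih (f t) (hn ▸ hlt) hI rfl
  · induction ht with
    | refl => exact hs
    | tail _ h ih => exact (hstep _ _ ih h).1

lemma Guarantees.mono {σ : Type*} {step : σ → σ → Prop} {s : σ} {Q Q' : σ → Prop}
    (h : Guarantees step s Q) (hQ : ∀ t, Q t → Q' t) : Guarantees step s Q' :=
  ⟨h.1, fun t ht hs => hQ t (h.2 t ht hs)⟩

/-! ### Correctness of PC with a d-separation oracle. -/

namespace PC

variable {V : Type*} {D : DAG V} {indep : V → V → Finset V → Prop}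

lemma Returns.mono {Q Q' : DAG V → Prop} (h : Returns indep Q) (hQ : ∀ H, Q H → Q' H) :
    Returns indep Q' :=
  Guarantees.mono h fun _ hs => hs.mono fun _ hP => ⟨hP.1, fun H hH => hQ H (hP.2 H hH)⟩

/-- The test answers the independence queries like d-separation in `D`. -/
def IsOracle (D : DAG V) (indep : V → V → Finset V → Prop) : Prop :=
  ∀ (u v : V) (Z : Finset V), u ≠ v → u ∉ Z → v ∉ Z → (indep u v Z ↔ D.DSep u v Z)

lemma SkelState.Removable.dSep (hI : IsOracle D indep) {s : SkelState V} {x y : V} {S : Finset V}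
    (h : s.Removable indep x y S) : x ∉ S ∧ y ∉ S ∧ D.DSep x y S := by
  obtain ⟨hadj, hS, -, hi⟩ := h
  have hx : x ∉ S := fun hx => s.graph.loopless.irrefl x (hS hx).1
  have hy : y ∉ S := fun hy => (hS hy).2 rfl
  exact ⟨hx, hy, (hI x y S hadj.ne hx hy).1 hi⟩

/-- Recorded separating sets separate the non-adjacent nodes. -/
def Separates (D : DAG V) (s : SkelState V) : Prop :=
  ∀ x y, x ≠ y → ¬ s.graph.Adj x y →
    x ∉ s.sepset s(x, y) ∧ y ∉ s.sepset s(x, y) ∧ D.DSep x y (s.sepset s(x, y))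

/-- Invariant of the edge-deletion phase. -/
structure SkelInvariant (D : DAG V) (indep : V → V → Finset V → Prop) (s : SkelState V) :
    Prop where
  le : D.skeleton ≤ s.graph
  separates : Separates D s
  tested : ∀ x y (S : Finset V), s.graph.Adj x y → (S : Set V) ⊆ s.graph.neighborSet x \ {y} →
    S.card < s.level → ¬ indep x y S

lemma SkelInvariant.init : SkelInvariant D indep (SkelState.init V) where
  le := le_top
  separates x y hne h := (h hne).elim
  tested x y S _ _ h := by simp [SkelState.init] at h

open Classical in
lemma SkelInvariant.step [Finite V] (hI : IsOracle D indep) {s t : SkelState V}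
    (hs : SkelInvariant D indep s) (h : SkelStep indep s t) :
    SkelInvariant D indep t ∧
      t.graph.edgeSet.ncard + (Nat.card V - t.level) <
        s.graph.edgeSet.ncard + (Nat.card V - s.level) := by
  cases h with
  | delete x y S h =>
    obtain ⟨hx, hy, hsep⟩ := h.dSep hI
    refine ⟨⟨fun a b hab => ?_, fun a b hne hab => ?_, fun a b T hab hT hc => ?_⟩, ?_⟩
    · rw [SimpleGraph.deleteEdges_adj]
      refine ⟨hs.le hab, fun e => ?_⟩
      rcases Sym2.eq_iff.1 (Set.mem_singleton_iff.1 e) with ⟨rfl, rfl⟩ | ⟨rfl, rfl⟩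
      · exact hsep (DAG.dConnected_of_skeleton_adj hx hy hab)
      · exact hsep (DAG.dConnected_of_skeleton_adj hx hy hab.symm)
    · rw [SimpleGraph.deleteEdges_adj, Set.mem_singleton_iff, not_and, not_not] at hab
      by_cases e : s(a, b) = s(x, y)
      · simp only [e, Function.update_self]
        rcases Sym2.eq_iff.1 e with ⟨rfl, rfl⟩ | ⟨rfl, rfl⟩
        · exact ⟨hx, hy, hsep⟩
        · exact ⟨hy, hx, hsep.symm hx hy⟩
      · simp only [Function.update_of_ne e]
        exact hs.separates a b hne fun h => e (hab h)
    · refine hs.tested a b T (SimpleGraph.deleteEdges_le _ hab) (hT.trans ?_) hc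
      exact Set.sdiff_subset_sdiff_left fun c hc => SimpleGraph.deleteEdges_le _ hc
    · refine Nat.add_lt_add_right (Set.ncard_lt_ncard ?_ (Set.toFinite _)) _
      rw [SimpleGraph.edgeSet_ssubset_edgeSet]
      refine lt_of_le_of_ne (SimpleGraph.deleteEdges_le _) fun e => ?_
      have := h.1
      rw [← e, SimpleGraph.deleteEdges_adj] at this
      exact this.2 rfl
  | next hdone hmore =>
    refine ⟨⟨hs.le, hs.separates, fun a b T hab hT hc hi => ?_⟩, ?_⟩
    · rcases Nat.lt_succ_iff_lt_or_eq.1 hc with hc | hc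
      · exact hs.tested a b T hab hT hc hi
      · exact hdone a b T ⟨hab, hT, hc, hi⟩
    -- Some neighbourhood has at least `level + 1` elements, so the level is below `Nat.card V` and
    -- the truncated difference really drops.
    · obtain ⟨x, y, -, hle⟩ := hmore
      have := hle.trans (Set.ncard_le_card _)
      simp only
      omega

lemma SkelInvariant.graph_eq [Finite V] (hI : IsOracle D indep) {s : SkelState V}
    (hs : SkelInvariant D indep s) (hfinal : ∀ t, ¬ SkelStep indep s t) :
    s.graph = D.skeleton := by
  classical
  have hdone : ∀ x y S, ¬ s.Removable indep x y S := fun x y S h => hfinal _ (.delete s x y S h)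
  have hmore : ∀ x y, s.graph.Adj x y → (s.graph.neighborSet x \ {y}).ncard ≤ s.level := by
    intro x y hxy
    by_contra hlt
    exact hfinal _ (.next s hdone ⟨x, y, hxy, by omega⟩)
  have key : ∀ x y, s.graph.Adj x y → ¬ D.skeleton.Adj x y → D.Descendant x y := by
    intro x y hxy hn
    by_contra hd
    -- The parents of `x` separate `x` from the non-descendant `y`. They are neighbours of `x`, so
    -- their number is at most the final level and this set has been tested.
    let P : Finset V := (Set.toFinite {b | D.Adj b x}).toFinset
    have hP : ∀ b, b ∈ P ↔ D.Adj b x := by simp [P]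
    have hsub : (P : Set V) ⊆ s.graph.neighborSet x \ {y} := by
      intro b hb
      have hb := (hP b).1 hb
      refine ⟨hs.le (DAG.skeleton_of_adj hb).symm, ?_⟩
      rintro rfl
      exact hn (DAG.skeleton_of_adj hb).symm
    have hi : indep x y P := (hI x y P hxy.ne
      (fun h => DAG.adj_asymm ((hP x).1 h) ((hP x).1 h)) fun h => (hsub h).2 rfl).2
      (DAG.dSep_parents hxy.ne hn hd hP)
    have hcard : P.card ≤ s.level := by
      rw [← Set.ncard_coe_finset]
      exact (Set.ncard_le_ncard hsub (Set.toFinite _)).trans (hmore x y hxy)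
    rcases hcard.lt_or_eq with h | h
    · exact hs.tested x y P hxy hsub h hi
    · exact hdone x y P ⟨hxy, hsub, h, hi⟩
  refine le_antisymm (fun x y hxy => ?_) hs.le
  by_contra hn
  exact D.acyclic x ((key x y hxy hn).trans (key y x hxy.symm fun h => hn h.symm))

/-- Invariant of the orientation phases. -/
structure PatternInvariant (D : DAG V) (P : Pattern V) : Prop where
  graph_eq : P.graph = D.skeleton
  adj_of_head : ∀ a b, P.head a b → D.Adj a b
  head_of_collider : ∀ a b c, a ≠ c → D.Adj a b → D.Adj c b → ¬ D.skeleton.Adj a c → P.head a b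

lemma PatternInvariant.colliders {s : SkelState V} (hg : s.graph = D.skeleton)
    (hs : Separates D s) : PatternInvariant D (Pattern.colliders s) where
  graph_eq := hg
  adj_of_head := by
    rintro a b ⟨z, hne, hab, hzb, haz, hb⟩
    obtain ⟨ha, hz, hsep⟩ := hs a z hne haz
    exact ((hsep.mem_iff ha hz (hg ▸ hab) (hg ▸ hzb)).1 hb).1
  head_of_collider := by
    intro a b c hne hab hcb hac
    have hac' : ¬ s.graph.Adj a c := hg ▸ hac
    obtain ⟨ha, hc, hsep⟩ := hs a c hne hac'
    have hab' := DAG.skeleton_of_adj hab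
    have hcb' := DAG.skeleton_of_adj hcb
    exact ⟨c, hne, hg ▸ hab', hg ▸ hcb', hac', (hsep.mem_iff ha hc hab' hcb').2 ⟨hab, hcb⟩⟩

namespace PatternInvariant

variable {P P' : Pattern V}

lemma adj_of_directed (hP : PatternInvariant D P) {a b : V} (h : P.Directed a b) : D.Adj a b :=
  hP.adj_of_head a b h.2.1

lemma orient (hP : PatternInvariant D P) {a b : V} (h : D.Adj a b) :
    PatternInvariant D (P.orient a b) where
  graph_eq := hP.graph_eq
  adj_of_head := by
    rintro x y (hxy | ⟨rfl, rfl⟩)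
    · exact hP.adj_of_head x y hxy
    · exact h
  head_of_collider x y z hne hxy hzy hxz := .inl (hP.head_of_collider x y z hne hxy hzy hxz)

lemma adj_of_undirected (hP : PatternInvariant D P) {a b : V} (h : P.Undirected a b)
    (hn : ¬ D.Adj b a) : D.Adj a b := by
  have := h.1
  rw [hP.graph_eq] at this
  exact (DAG.skeleton_adj.1 this).resolve_right hn

lemma ncard_orient_lt [Finite V] {a b : V} (h : ¬ P.head a b) :
    {q : V × V | ¬ (P.orient a b).head q.1 q.2}.ncard < {q : V × V | ¬ P.head q.1 q.2}.ncard := by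
  refine Set.ncard_lt_ncard ⟨fun q hq hh => hq (.inl hh), fun hsub => ?_⟩ (Set.toFinite _)
  exact hsub (show (a, b) ∈ {q : V × V | ¬ P.head q.1 q.2} from h) (.inr ⟨rfl, rfl⟩)

/-- Each rule is sound because the opposite arc would create an unmarked v-structure or a directed
cycle in `D`. -/
lemma step [Finite V] (hP : PatternInvariant D P) (h : Pattern.Step P P') :
    PatternInvariant D P' ∧
      {q : V × V | ¬ P'.head q.1 q.2}.ncard < {q : V × V | ¬ P.head q.1 q.2}.ncard := by
  cases h with
  | awayFromCollider a b c hab hbc hne hac =>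
    refine ⟨hP.orient (hP.adj_of_undirected hbc fun hcb => hbc.2.2 ?_), ncard_orient_lt hbc.2.1⟩
    rw [hP.graph_eq] at hac
    exact hP.head_of_collider c b a hne.symm hcb (hP.adj_of_directed hab) fun h => hac h.symm
  | awayFromCycle a b hpath hab =>
    refine ⟨hP.orient (hP.adj_of_undirected hab fun hba => ?_), ncard_orient_lt hab.2.1⟩
    exact D.acyclic a ((Relation.TransGen.mono (fun _ _ => hP.adj_of_directed) a b hpath).tail hba)

lemma directed_of_collider (hP : PatternInvariant D P) {a b c : V} (hne : a ≠ c)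
    (hab : D.Adj a b) (hcb : D.Adj c b) (hac : ¬ D.skeleton.Adj a c) : P.Directed a b :=
  ⟨hP.graph_eq ▸ DAG.skeleton_of_adj hab, hP.head_of_collider a b c hne hab hcb hac,
    fun h => DAG.adj_asymm hab (hP.adj_of_head b a h)⟩

lemma represents (hP : PatternInvariant D P) : P.Represents D := by
  refine ⟨hP.graph_eq.symm, fun a b => hP.adj_of_directed, fun a b c hne hab hcb hac => ?_⟩
  rw [hP.graph_eq] at hac
  exact ⟨hP.directed_of_collider hne hab hcb hac,
    hP.directed_of_collider hne.symm hcb hab fun h => hac h.symm⟩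

lemma markovEquivalent (hP : PatternInvariant D P) {H : DAG V} (hH : P.Represents H) :
    H.MarkovEquivalent D := by
  obtain ⟨hskel, hdir, hcol⟩ := hH
  refine DAG.SameVStructures.markovEquivalent ⟨hskel.trans hP.graph_eq, ?_⟩
  intro a b c hne hac
  rw [hskel] at hac
  constructor
  · rintro ⟨hab, hcb⟩
    have := hcol a b c hne hab hcb hac
    exact ⟨hP.adj_of_directed this.1, hP.adj_of_directed this.2⟩
  · rintro ⟨hab, hcb⟩
    have := hP.represents.2.2 a b c hne hab hcb hac
    exact ⟨hdir a b this.1, hdir c b this.2⟩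

end PatternInvariant

/-- Correctness of the PC algorithm. -/
theorem returns_of_isOracle [Finite V] (hI : IsOracle D indep) :
    Returns indep fun H => H.MarkovEquivalent D := by
  refine guarantees_of_invariant (SkelInvariant D indep)
    (fun s => s.graph.edgeSet.ncard + (Nat.card V - s.level)) SkelInvariant.init
    (fun s t hs h => hs.step hI h) fun s hs hfinal => ?_
  refine guarantees_of_invariant (PatternInvariant D)
    (fun P => {q : V × V | ¬ P.head q.1 q.2}.ncard)
    (PatternInvariant.colliders (hs.graph_eq hI hfinal) hs.separates)
    (fun P P' hP h => hP.step h) fun P hP _ => ?_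
  exact ⟨⟨D, hP.represents⟩, fun H hH => hP.markovEquivalent hH⟩

end PC

/-! ### From variables to groups. -/

section Main

variable {N : Type*} [Fintype N] {α : N → Type*} [∀ v, MeasurableSpace (α v)]
  [∀ v, StandardBorelSpace (α v)] {p : Measure (∀ v, α v)} [IsFiniteMeasure p]

lemma Faithful.congr {A H : DAG N} (h : Faithful p A) (hH : H.MarkovEquivalent A) :
    Faithful p H :=
  fun u v Z huv hu hv => (h u v Z huv hu hv).trans (hH u v Z huv hu hv).symm

variable [DecidableEq N]

/-- Faithfulness extends from pairs of variables to pairs of sets of variables. -/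
lemma Faithful.condIndepSets_iff {H : DAG N} (h : Faithful p H) {T U Z : Finset N}
    (hTU : Disjoint T U) (hTZ : Disjoint T Z) (hUZ : Disjoint U Z) :
    CondIndepSets p T U Z ↔ H.SetDSep T U Z := by
  have hne : ∀ t ∈ T, ∀ u ∈ U, t ≠ u := fun t ht u hu e => Finset.disjoint_left.1 hTU ht (e ▸ hu)
  constructor
  · intro hc t ht u hu
    exact (h t u Z (hne t ht u hu) (Finset.disjoint_left.1 hTZ ht)
      (Finset.disjoint_left.1 hUZ hu)).1
      (hc.mono (Finset.singleton_subset_iff.2 ht) (Finset.singleton_subset_iff.2 hu))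
  · intro hs
    -- Contraction asks for independence of `t` and `u` under all enlarged conditions; weak union
    -- for d-separation supplies them.
    refine condIndepSets_of_forall_subset fun t ht u hu T' hT' U' hU' => ?_
    have htF : t ∉ T' ∪ U' := by
      rw [Finset.mem_union]
      rintro (h | h)
      · exact Finset.notMem_erase t T (hT' h)
      · exact Finset.disjoint_left.1 hTU ht (Finset.mem_of_mem_erase (hU' h))
    have huF : u ∉ T' ∪ U' := by
      rw [Finset.mem_union]
      rintro (h | h)
      · exact Finset.disjoint_left.1 hTU (Finset.mem_of_mem_erase (hT' h)) hu
      · exact Finset.notMem_erase u U (hU' h)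
    rw [Finset.union_assoc]
    refine (h t u _ (hne t ht u hu) ?_ ?_).2 (hs.dSep_union hTU hTZ hUZ
      (Finset.union_subset_union (hT'.trans (Finset.erase_subset _ _))
        (hU'.trans (Finset.erase_subset _ _))) ht hu htF huF)
    · rw [Finset.mem_union, not_or]
      exact ⟨Finset.disjoint_left.1 hTZ ht, htF⟩
    · rw [Finset.mem_union, not_or]
      exact ⟨Finset.disjoint_left.1 hUZ hu, huF⟩

lemma disjoint_unionOf {W : Finpartition (Finset.univ : Finset N)} {A : W.parts}
    {T : Finset W.parts} (hA : A ∉ T) : Disjoint A.1 (unionOf T) := by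
  rw [unionOf, Finset.disjoint_biUnion_right]
  exact fun B hB => W.disjoint A.2 B.2 fun e => hA (Subtype.ext e ▸ hB)

/-- `FindGroupDAG2` is correct whenever the test is right about all pairs of variables. -/
theorem findGroupDAG2Returns {A : DAG N} (hA : Faithful p A)
    {W : Finpartition (Finset.univ : Finset N)} {G' : DAG W.parts}
    (hgroup : GroupwiseFaithful p W G') {indep : N → N → Finset N → Prop}
    (hindep : ∀ u v Z, u ≠ v → u ∉ Z → v ∉ Z → (indep u v Z ↔ CondIndepSets p {u} {v} Z)) :
    FindGroupDAG2Returns indep W fun H => H.MarkovEquivalent G' := by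
  have hI : PC.IsOracle A indep := fun u v Z huv hu hv =>
    (hindep u v Z huv hu hv).trans (hA u v Z huv hu hv)
  refine (PC.returns_of_isOracle hI).mono fun H hH => PC.returns_of_isOracle ?_
  intro X Y T hXY hX hY
  have hdisj : Disjoint X.1 Y.1 := W.disjoint X.2 Y.2 fun e => hXY (Subtype.ext e)
  exact ((hA.congr hH).condIndepSets_iff hdisj (disjoint_unionOf hX)
    (disjoint_unionOf hY)).symm.trans (hgroup X Y T hXY hX hY)

end Main

end GroupDAG

theorem mainTheorem6 {N : Type*} [Fintype N] [DecidableEq N]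
    {α : N → Type*} [∀ v, MeasurableSpace (α v)] [∀ v, StandardBorelSpace (α v)]
    (B : GroupDAG.BayesNet α) (p : Measure (∀ v, α v)) [IsProbabilityMeasure p]
    (hp : B.Generates p)
    (hfaithful : ∃ A : GroupDAG.DAG N, GroupDAG.Faithful p A)
    (W : Finpartition (Finset.univ : Finset N)) (G' : GroupDAG.DAG W.parts)
    (hgroup : GroupDAG.GroupwiseFaithful p W G') :
    -- infinite sample: the independence test of the first run of PC is exact
    GroupDAG.FindGroupDAG2Returns (fun u v Z => GroupDAG.CondIndepSets p {u} {v} Z) W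
        (fun H => H.MarkovEquivalent G') ∧
      -- sample size tending to infinity, with consistent independence tests on the data
      ∀ test : (n : ℕ) → (Fin n → ∀ v, α v) → N → N → Finset N → Prop,
        GroupDAG.ConsistentTests p test →
          Tendsto (fun n => Measure.pi (fun _ : Fin n => p)
            {D | ¬ GroupDAG.FindGroupDAG2Returns (test n D) W
              (fun H => H.MarkovEquivalent G')}) atTop (𝓝 0) := by
  obtain ⟨A, hA⟩ := hfaithful
  refine ⟨GroupDAG.findGroupDAG2Returns hA hgroup fun _ _ _ _ _ _ => Iff.rfl,
    fun test htest => ?_⟩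
  -- Only admissible queries count: consistency covers no others, and PC's correctness needs no
  -- others.
  let wrong (n : ℕ) (q : N × N × Finset N) : Set (Fin n → ∀ v, α v) :=
    {D | q.1 ≠ q.2.1 ∧ q.1 ∉ q.2.2 ∧ q.2.1 ∉ q.2.2 ∧
      ¬ (test n D q.1 q.2.1 q.2.2 ↔ GroupDAG.CondIndepSets p {q.1} {q.2.1} q.2.2)}
  have hlim : ∀ q, Tendsto (fun n => Measure.pi (fun _ : Fin n => p) (wrong n q)) atTop (𝓝 0) := by
    intro q
    by_cases hq : q.1 ≠ q.2.1 ∧ q.1 ∉ q.2.2 ∧ q.2.1 ∉ q.2.2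
    · refine tendsto_of_tendsto_of_tendsto_of_le_of_le tendsto_const_nhds
        (htest q.1 q.2.1 q.2.2 hq.1 hq.2.1 hq.2.2) (fun _ => zero_le)
        fun n => measure_mono fun D hD => hD.2.2.2
    · have : ∀ n, wrong n q = ∅ := fun n =>
        Set.eq_empty_of_forall_notMem fun D hD => hq ⟨hD.1, hD.2.1, hD.2.2.1⟩
      simp [this]
  have hsum := tendsto_finsetSum Finset.univ fun q _ => hlim q
  rw [Finset.sum_const_zero] at hsum
  refine tendsto_of_tendsto_of_tendsto_of_le_of_le tendsto_const_nhds hsum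
    (fun _ => zero_le) fun n => ?_
  -- Monotonicity and subadditivity hold for outer measure, so no event has to be measurable.
  refine (measure_mono fun D hD => ?_).trans
    (measure_biUnion_finset_le Finset.univ fun q => wrong n q)
  by_contra hn
  refine hD (GroupDAG.findGroupDAG2Returns hA hgroup fun u v Z huv hu hv => ?_)
  by_contra hw
  exact hn (Set.mem_biUnion (Finset.mem_coe.2 (Finset.mem_univ (u, v, Z))) ⟨huv, hu, hv, hw⟩)
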